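/- Setting. Let $\mathcal A$ (applicants) and $\mathcal P_0$ (posts) be finite sets and let a bipartite graph on $\mathcal A\cup\mathcal P_0$ be given whose edges carry ranks in $\{1,\dots,r\}$ (ties allowed); $\mathrm{rank}(a,p)$ is the rank of the edge $(a,p)$. For every applicant $a$ add a new last-resort post $\ell(a)$, joined only to $a$, by an edge of rank $r+1$. Let $G=(\mathcal A\cup\mathcal P,E)$ be the resulting graph and $E_i$ its set of edges of rank $i$, $1\le i\le r+1$. The signature of a matching $M$ of $G$ is $(x_1,\dots,x_{r+1})$, where $x_i=|M\cap E_i|$; $M$ is rank-maximal if its signature is lexicographically maximum among all matchings of $G$. Reduced graphs. Given a maximum matching $N$ of a bipartite graph, a vertex is even (resp. odd) if an even (resp. odd) length $N$-alternating path leads to it from an $N$-unmatched vertex, and unreachable if no $N$-alternating path leads to it from an $N$-unmatched vertex. Put $G'_1=(\mathcal A\cup\mathcal P,E_1)$. For $i=1,\dots,r+1$ choose any maximum matching $N_i$ of $G'_i$, let $\mathcal E_i,\mathcal O_i,\mathcal U_i$ be the sets of even, odd and unreachable vertices of $G'_i$ with respect to $N_i$; delete all edges of rank greater than $i$ incident to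 $\mathcal O_i\cup\mathcal U_i$; delete from $G'_i$ all edges between $\mathcal O_i$ and $\mathcal O_i\cup\mathcal U_i$; and, if $i\le r$, add the edges of $E_{i+1}$ not deleted so far to obtain $G'_{i+1}$. The graph obtained after iteration $r+1$ is the reduced graph $G'=(\mathcal A\cup\mathcal P,E')$. Switching graph. Let $M$ be a rank-maximal matching of $G$. The directed graph $G_M$ has vertex set $\mathcal P$ and an edge $(p,q)$ whenever there is $a\in\mathcal A$ with $(a,p)\in M$ and $(a,q)\in E'$; its weight is $w(p,q)=\mathrm{rank}(a,q)-\mathrm{rank}(a,p)$. A sink is a post $p\in\mathcal E_1\cap\dots\cap\mathcal E_{r+1}$ with no outgoing edge in $G_M$ to a post other than $p$. A switching path is a path $T=\langle p_0,\dots,p_{k-1}\rangle$ in $G_M$ ($k\ge1$, distinct posts) that ends in a sink and has total weight $0$. A switching cycle is a cycle $C=\langle p_0,\dots,p_{k-1},p_0\rangle$ in $G_M$ ($k\ge1$, $p_0,\dots,p_{k-1}$ distinct) of total weight $0$. $M\cdot T$ is obtained from $M$ by rematching the partner of $p_i$ to $p_{i+1}$ for $0\le i\le k-2$, applicants whose post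 is not on $T$ keeping it; $M\cdot C$ is obtained by rematching the partner of $p_i$ to $p_{i+1\bmod k}$ for $0\le i\le k-1$, applicants whose post is not on $C$ keeping it. Lemma. For every rank-maximal matching $M$ of $G$, every switching path $T$ and every switching cycle $C$ in $G_M$, both $M\cdot T$ and $M\cdot C$ are rank-maximal matchings of $G$. -/

import Mathlib

/-- An instance of the rank-maximal matchings problem with applicants `A` and posts `P`: the
edge set `E` of a bipartite graph, and a rank between `1` and `r` for each edge. The class `E_i`
of the partition of `E` is the set of edges of rank `i`. Ties are allowed, and values of `rank`
outside `E` are never used. -/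
structure RankedInstance (A P : Type*) where
  r : ℕ
  E : Finset (A × P)
  rank : A → P → ℕ
  one_le_rank : ∀ e ∈ E, 1 ≤ rank e.1 e.2
  rank_le : ∀ e ∈ E, rank e.1 e.2 ≤ r

namespace RankedInstance

/-! ### Matchings in bipartite graphs, given by sets of edges -/

section Bipartite

variable {A P : Type*}

/-- `N` is a matching of the bipartite graph with edge set `H`. -/
def IsMatching (H N : Finset (A × P)) : Prop :=
  N ⊆ H ∧ ∀ e ∈ N, ∀ f ∈ N, (e.1 = f.1 ∨ e.2 = f.2) → e = f

/-- `N` is a matching of maximum cardinality of the bipartite graph with edge set `H`. -/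
def IsMaximumMatching (H N : Finset (A × P)) : Prop :=
  IsMatching H N ∧ ∀ N' : Finset (A × P), IsMatching H N' → N'.card ≤ N.card

/-- The bipartite graph on `A ⊕ P` with edge set `H`. -/
def bipGraph (H : Finset (A × P)) : SimpleGraph (A ⊕ P) :=
  SimpleGraph.fromRel fun x y => ∃ a p, (a, p) ∈ H ∧ x = Sum.inl a ∧ y = Sum.inr p

/-- The vertex `v` is left unmatched by `N`. -/
def IsUnmatched (N : Finset (A × P)) (v : A ⊕ P) : Prop :=
  ∀ u, ¬ (bipGraph N).Adj v u

/-- Of any two consecutive edges of the walk `w`, exactly one belongs to `N`. -/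
def IsAlternating {H : Finset (A × P)} (N : Finset (A × P)) {u v : A ⊕ P}
    (w : (bipGraph H).Walk u v) : Prop :=
  List.IsChain (fun e f => e ∈ (bipGraph N).edgeSet ↔ f ∉ (bipGraph N).edgeSet) w.edges

/-- In the graph with edge set `H` there is an even length alternating path with respect to
`N` from an unmatched vertex to `v`. -/
def IsEvenVertex (H N : Finset (A × P)) (v : A ⊕ P) : Prop :=
  ∃ u, IsUnmatched N u ∧ ∃ w : (bipGraph H).Walk u v,
    w.IsPath ∧ IsAlternating N w ∧ Even w.length

/-- In the graph with edge set `H` there is an odd length alternating path with respect to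
`N` from an unmatched vertex to `v`. -/
def IsOddVertex (H N : Finset (A × P)) (v : A ⊕ P) : Prop :=
  ∃ u, IsUnmatched N u ∧ ∃ w : (bipGraph H).Walk u v,
    w.IsPath ∧ IsAlternating N w ∧ Odd w.length

/-- In the graph with edge set `H` there is no alternating path with respect to `N` from an
unmatched vertex to `v`. -/
def IsUnreachableVertex (H N : Finset (A × P)) (v : A ⊕ P) : Prop :=
  ¬ ∃ u, IsUnmatched N u ∧ ∃ w : (bipGraph H).Walk u v, w.IsPath ∧ IsAlternating N w

/-- The vertex `v` is odd or unreachable. -/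
def IsOddOrUnreachable (H N : Finset (A × P)) (v : A ⊕ P) : Prop :=
  IsOddVertex H N v ∨ IsUnreachableVertex H N v

/-- The edge `e` joins an odd vertex to an odd or unreachable vertex. -/
def IsOddOddOrOddUnreachable (H N : Finset (A × P)) (e : A × P) : Prop :=
  (IsOddVertex H N (Sum.inl e.1) ∧ IsOddOrUnreachable H N (Sum.inr e.2)) ∨
    (IsOddVertex H N (Sum.inr e.2) ∧ IsOddOrUnreachable H N (Sum.inl e.1))

end Bipartite

/-! ### Last-resort posts -/

open Classical in
/-- The instance obtained by adding, for each applicant `a`, a last-resort post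
`ℓ(a) = Sum.inr a`, which only `a` ranks, at rank `r + 1`. -/
noncomputable def withLastResorts {A P : Type*} [Fintype A] [Fintype P]
    (I : RankedInstance A P) : RankedInstance A (P ⊕ A) where
  r := I.r + 1
  E := I.E.image (fun e => (e.1, Sum.inl e.2)) ∪
    Finset.univ.image (fun a : A => (a, Sum.inr a))
  rank a q := Sum.elim (fun p => I.rank a p) (fun _ => I.r + 1) q
  one_le_rank := by
    intro e he
    rcases Finset.mem_union.1 he with h | h
    · obtain ⟨f, hf, rfl⟩ := Finset.mem_image.1 h
      exact I.one_le_rank f hf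
    · obtain ⟨a, -, rfl⟩ := Finset.mem_image.1 h
      exact Nat.le_add_left 1 I.r
  rank_le := by
    intro e he
    rcases Finset.mem_union.1 he with h | h
    · obtain ⟨f, hf, rfl⟩ := Finset.mem_image.1 h
      exact (I.rank_le f hf).trans (Nat.le_succ _)
    · obtain ⟨a, -, rfl⟩ := Finset.mem_image.1 h
      exact le_rfl

section Instance

variable {A P : Type*} (I : RankedInstance A P)

/-! ### Rank-maximal matchings -/

/-- The `i`-th entry of the signature of `M`: the number of applicants that `M` matches to a
post of rank `i`. -/
def signature (M : Finset (A × P)) (i : ℕ) : ℕ :=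
  (M.filter fun e => I.rank e.1 e.2 = i).card

/-- The signature of `M` is larger than that of `M'` in the lexicographic order: it is larger
at the first place `k ∈ {1, …, r}` where the two differ. -/
def Succ (M M' : Finset (A × P)) : Prop :=
  ∃ k, 1 ≤ k ∧ k ≤ I.r ∧ (∀ i, 1 ≤ i → i < k → I.signature M i = I.signature M' i) ∧
    I.signature M' k < I.signature M k

/-- `M` is a rank-maximal matching: no matching has a larger signature. -/
def IsRankMaximal (M : Finset (A × P)) : Prop :=
  IsMatching I.E M ∧ ∀ M' : Finset (A × P), IsMatching I.E M' → ¬ I.Succ M' M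

/-! ### The algorithm of Irving et al.

`N i` is the maximum matching that the algorithm uses in iteration `i ≥ 1`. -/

variable (N : ℕ → Finset (A × P))

open Classical in
/-- The edges, of all ranks, that have not been deleted when iteration `i` is over. Iteration
`i + 1` works in the graph formed by the remaining edges of rank at most `i + 1`; there it
classifies the vertices with respect to `N (i + 1)`, and it deletes the edges of higher rank
that meet an odd or unreachable vertex, and, among the edges of that graph, those that join an
odd vertex to an odd or unreachable one. -/
noncomputable def remaining : ℕ → Finset (A × P)
  | 0 => I.E
  | i + 1 =>
    let H := (remaining i).filter fun e => I.rank e.1 e.2 ≤ i + 1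
    (remaining i).filter fun e =>
      ¬ (i + 1 < I.rank e.1 e.2 ∧
          (IsOddOrUnreachable H (N (i + 1)) (Sum.inl e.1) ∨
            IsOddOrUnreachable H (N (i + 1)) (Sum.inr e.2))) ∧
        ¬ (I.rank e.1 e.2 ≤ i + 1 ∧ IsOddOddOrOddUnreachable H (N (i + 1)) e)

/-- The graph `G'_i` of iteration `i ≥ 1`: the edges of rank at most `i` that were not deleted
in the iterations `1, …, i - 1`. -/
noncomputable def stageGraph (i : ℕ) : Finset (A × P) :=
  (I.remaining N (i - 1)).filter fun e => I.rank e.1 e.2 ≤ i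

/-- `N 1, …, N r` are the matchings of a run of the algorithm: `N i` is a maximum matching of
`G'_i`. (How it is found is irrelevant: `N i` may but need not arise from `N (i - 1)` by
augmentation.) -/
def IsRun : Prop :=
  ∀ i, 1 ≤ i → i ≤ I.r → IsMaximumMatching (I.stageGraph N i) (N i)

/-- The reduced graph `G'`: the edges that remain after all `r` iterations. -/
noncomputable def reducedGraph : Finset (A × P) :=
  I.remaining N I.r

/-! ### The switching graph -/

variable (M : Finset (A × P))

/-- `(p, q)` is an edge of the switching graph `G_M`. -/
def SwitchEdge (p q : P) : Prop :=
  ∃ a, (a, p) ∈ M ∧ (a, q) ∈ I.reducedGraph N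

open Classical in
/-- The weight `rank(a, q) - rank(a, p)` of the edge `(p, q)` of `G_M`, where `a` is the
partner of `p` in `M`. For a matching `M` and a matched post `p` the sum has exactly one term. -/
noncomputable def weight (p q : P) : ℤ :=
  ∑ e ∈ M.filter (fun e => e.2 = p), ((I.rank e.1 q : ℤ) - (I.rank e.1 p : ℤ))

/-- The post `p` is a sink of `G_M`: it has no edge to another post, and it is even in each of
the graphs `G'_1, …, G'_r`. (A matched post carries the trivial loop given by its own matching
edge; that loop does not count here.) -/
def IsSink (p : P) : Prop :=
  (∀ q, q ≠ p → ¬ I.SwitchEdge N M p q) ∧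
    ∀ i, 1 ≤ i → i ≤ I.r → IsEvenVertex (I.stageGraph N i) (N i) (Sum.inr p)

/-- `⟨T 0, …, T n⟩` is a switching path: a path in `G_M` of weight zero that ends in a sink. -/
def IsSwitchingPath {n : ℕ} (T : Fin (n + 1) → P) : Prop :=
  Function.Injective T ∧
    (∀ i : Fin n, I.SwitchEdge N M (T i.castSucc) (T i.succ)) ∧
    I.IsSink N M (T (Fin.last n)) ∧
    ∑ i : Fin n, I.weight M (T i.castSucc) (T i.succ) = 0

/-- `⟨C 0, …, C n, C 0⟩` is a switching cycle: a cycle in `G_M` of weight zero. The index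
`i + 1` is taken cyclically, so it is `0` for `i = n`. -/
def IsSwitchingCycle {n : ℕ} (C : Fin (n + 1) → P) : Prop :=
  Function.Injective C ∧
    (∀ i : Fin (n + 1), I.SwitchEdge N M (C i) (C (i + 1))) ∧
    ∑ i : Fin (n + 1), I.weight M (C i) (C (i + 1)) = 0

end Instance

section Switching

variable {A P : Type*} [Fintype A] [Fintype P] (M : Finset (A × P))

open Classical in
/-- `M · T`: the partner of `T i` (`i < n`) is moved to `T (i + 1)`; applicants whose partner
is not on `T` keep it. -/
noncomputable def applyPath {n : ℕ} (T : Fin (n + 1) → P) : Finset (A × P) :=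
  Finset.univ.filter fun e =>
    (e ∈ M ∧ e.2 ∉ Set.range T) ∨
      ∃ i : Fin n, (e.1, T i.castSucc) ∈ M ∧ e.2 = T i.succ

open Classical in
/-- `M · C`: the partner of `C i` is moved to `C (i + 1)` (cyclically); applicants whose
partner is not on `C` keep it. -/
noncomputable def applyCycle {n : ℕ} (C : Fin (n + 1) → P) : Finset (A × P) :=
  Finset.univ.filter fun e =>
    (e ∈ M ∧ e.2 ∉ Set.range C) ∨
      ∃ i : Fin (n + 1), (e.1, C i) ∈ M ∧ e.2 = C (i + 1)

end Switching

end RankedInstance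

open SimpleGraph

namespace RankedInstance

/-! ### Alternating paths and vertex parity in bipartite graphs. -/

section AlternatingPaths

variable {A P : Type*}

/-! A switch moves edges inside the reduced graph, keeps their number and changes the total rank by
its weight, which is zero. This suffices for rank-maximality. By `IsRankMaximal.subset_remaining`, a
rank-maximal `M` lies in the reduced graph and its edges of rank at most `i` form a maximum matching
of each `G'_i`. So a matching `K` of the reduced graph has at most as many edges of rank at most `i`
as `M`, for every `i`. Summed over `i < r`, these counts depend only on the number of edges and the
total rank; if both agree for `K` and `M`, all the inequalities are equalities and the signatures
coincide (`IsRankMaximal.of_sum_rank_eq`).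

The structural fact rests on König covers. The odd vertices and the unreachable vertices of one side
cover `G'_j` and have the size of a maximum matching, so every maximum matching is tight for this
cover and avoids the deleted edges. If the part of `M` in `G'_i` were not maximum, augmenting it
would lose no covered vertex. For `j < i` the number of edges of rank at most `j` equals the number
of covered vertices of the `j`-th cover (`card_upTo_eq`), so it cannot drop, and the signature would
improve.

A switch yields a matching because every post that receives an applicant is either vacated or
unmatched; for the end of a path this is `IsSink.notMem`. -/

/-- The two ends of the edge `e` as an unordered pair of vertices. -/
def ends (e : A × P) : Sym2 (A ⊕ P) := s(Sum.inl e.1, Sum.inr e.2)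

/-- The vertex `v` is matched by `N`. -/
def Covers (N : Finset (A × P)) (v : A ⊕ P) : Prop := ∃ e ∈ N, v ∈ ends e

lemma mem_edgeSet_bipGraph {H : Finset (A × P)} {s : Sym2 (A ⊕ P)} :
    s ∈ (bipGraph H).edgeSet ↔ ∃ e ∈ H, ends e = s := by
  induction s using Sym2.ind with
  | _ x y =>
    rw [mem_edgeSet, bipGraph, fromRel_adj]
    constructor
    · rintro ⟨-, ⟨a, p, h, rfl, rfl⟩ | ⟨a, p, h, rfl, rfl⟩⟩
      · exact ⟨_, h, rfl⟩
      · exact ⟨_, h, Sym2.eq_swap⟩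
    · rintro ⟨⟨a, p⟩, h, he⟩
      rcases Sym2.eq_iff.1 he with ⟨rfl, rfl⟩ | ⟨rfl, rfl⟩
      · exact ⟨by simp, Or.inl ⟨a, p, h, rfl, rfl⟩⟩
      · exact ⟨by simp, Or.inr ⟨a, p, h, rfl, rfl⟩⟩

lemma adj_bipGraph {H : Finset (A × P)} {x y : A ⊕ P} :
    (bipGraph H).Adj x y ↔ ∃ e ∈ H, ends e = s(x, y) := by
  rw [← mem_edgeSet, mem_edgeSet_bipGraph]

lemma isUnmatched_iff {N : Finset (A × P)} {v : A ⊕ P} : IsUnmatched N v ↔ ¬ Covers N v := by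
  simp only [IsUnmatched, adj_bipGraph, Covers]
  constructor
  · rintro h ⟨e, he, hv⟩
    obtain ⟨u, hu⟩ := Sym2.mem_iff_exists.1 hv
    exact h u ⟨e, he, hu⟩
  · rintro h u ⟨e, he, hu⟩
    exact h ⟨e, he, hu ▸ Sym2.mem_mk_left _ _⟩

/-- The colouring of the vertices by the two sides of the bipartite graph. -/
def sideColoring (H : Finset (A × P)) : (bipGraph H).Coloring Bool :=
  Coloring.mk Sum.isLeft fun {x y} h => by
    obtain ⟨e, -, he⟩ := adj_bipGraph.1 h
    rcases Sym2.eq_iff.1 he with ⟨rfl, rfl⟩ | ⟨rfl, rfl⟩ <;> simp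

lemma isMatching_iff {H N : Finset (A × P)} :
    IsMatching H N ↔ N ⊆ H ∧ ∀ e ∈ N, ∀ f ∈ N, ∀ v, v ∈ ends e → v ∈ ends f → e = f := by
  refine and_congr_right fun _ => forall₂_congr fun e _ => forall₂_congr fun f _ => ?_
  constructor
  · rintro h v hv hw
    simp only [ends, Sym2.mem_iff] at hv hw
    apply h
    rcases hv with rfl | rfl <;> rcases hw with hw | hw <;> simp_all
  · rintro h (h1 | h1)
    · exact h (Sum.inl e.1) (by simp [ends]) (by simp [ends, h1])
    · exact h (Sum.inr e.2) (by simp [ends]) (by simp [ends, h1])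

lemma IsMatching.eq_of_mem_ends {H N : Finset (A × P)} (h : IsMatching H N) {e f : A × P}
    (he : e ∈ N) (hf : f ∈ N) {v : A ⊕ P} (hv : v ∈ ends e) (hw : v ∈ ends f) : e = f :=
  (isMatching_iff.1 h).2 e he f hf v hv hw

lemma IsMatching.sym2_eq {H N : Finset (A × P)} (h : IsMatching H N) {s t : Sym2 (A ⊕ P)}
    (hs : s ∈ (bipGraph N).edgeSet) (ht : t ∈ (bipGraph N).edgeSet) {v : A ⊕ P} (hv : v ∈ s)
    (hw : v ∈ t) : s = t := by
  obtain ⟨e, he, rfl⟩ := mem_edgeSet_bipGraph.1 hs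
  obtain ⟨f, hf, rfl⟩ := mem_edgeSet_bipGraph.1 ht
  rw [h.eq_of_mem_ends he hf hv hw]

lemma IsUnmatched.notMem_edgeSet {N : Finset (A × P)} {u : A ⊕ P} (hu : IsUnmatched N u)
    {s : Sym2 (A ⊕ P)} (hs : u ∈ s) : s ∉ (bipGraph N).edgeSet := by
  rintro h
  obtain ⟨e, he, rfl⟩ := mem_edgeSet_bipGraph.1 h
  exact isUnmatched_iff.1 hu ⟨e, he, hs⟩

variable {H N : Finset (A × P)}

lemma IsAlternating.of_concat {u v x : A ⊕ P} {w : (bipGraph H).Walk u v}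
    {h : (bipGraph H).Adj v x} (ha : IsAlternating N (w.concat h)) : IsAlternating N w := by
  rw [IsAlternating, Walk.edges_concat, List.concat_eq_append] at ha
  exact ha.left_of_append

lemma IsAlternating.takeUntil [DecidableEq (A ⊕ P)] {u v x : A ⊕ P} {w : (bipGraph H).Walk u v}
    (ha : IsAlternating N w) (hx : x ∈ w.support) : IsAlternating N (w.takeUntil x hx) := by
  rw [IsAlternating, ← w.take_spec hx, Walk.edges_append] at ha
  exact ha.left_of_append

/-- The first edge leaves an unmatched vertex, hence is not in `N`; alternation then fixes
membership of every later edge by its position. -/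
lemma IsAlternating.getLast_mem_iff {u v : A ⊕ P} {w : (bipGraph H).Walk u v}
    (hu : IsUnmatched N u) (ha : IsAlternating N w) {s : Sym2 (A ⊕ P)}
    (hs : s ∈ w.edges.getLast?) :
    v ∈ s ∧ (s ∈ (bipGraph N).edgeSet ↔ Even w.length) := by
  induction w using Walk.concatRec generalizing s with
  | Hnil => simp at hs
  | @Hconcat u v x p h ih =>
    have ih {s} := ih hu ha.of_concat (s := s)
    rw [Walk.edges_concat, List.concat_eq_append, List.getLast?_concat] at hs
    obtain rfl : s(v, x) = s := by simpa using hs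
    refine ⟨Sym2.mem_mk_right _ _, ?_⟩
    rw [Walk.length_concat, Nat.even_add_one]
    rw [IsAlternating, Walk.edges_concat, List.concat_eq_append, List.isChain_append] at ha
    rcases hl : p.edges.getLast? with _ | t
    · have hn : p.edges = [] := by simpa using hl
      have hlen : p.length = 0 := by rw [← Walk.length_edges, hn]; rfl
      obtain rfl := Walk.eq_of_length_eq_zero hlen
      have := hu.notMem_edgeSet (Sym2.mem_mk_left u x)
      simp only [hlen, Even.zero, not_true_eq_false, iff_false]
      exact this
    · have h1 := (ih (by rw [hl]; rfl)).2
      have h2 := ha.2.2 t (by rw [hl]; rfl) s(v, x) (by simp)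
      tauto

lemma isAlternating_concat {u v x : A ⊕ P} {w : (bipGraph H).Walk u v}
    (h : (bipGraph H).Adj v x) (ha : IsAlternating N w)
    (hl : ∀ s ∈ w.edges.getLast?, (s ∈ (bipGraph N).edgeSet ↔ s(v, x) ∉ (bipGraph N).edgeSet)) :
    IsAlternating N (w.concat h) := by
  rw [IsAlternating, Walk.edges_concat, List.concat_eq_append, List.isChain_append]
  refine ⟨ha, List.isChain_singleton _, fun s hs t ht => ?_⟩
  obtain rfl : s(v, x) = t := by simpa using ht
  exact hl s hs

lemma bipGraph_mono (h : N ⊆ H) {x y : A ⊕ P} (hxy : (bipGraph N).Adj x y) :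
    (bipGraph H).Adj x y := by
  obtain ⟨e, he, h2⟩ := adj_bipGraph.1 hxy
  exact adj_bipGraph.2 ⟨e, h he, h2⟩

lemma IsUnmatched.isEvenVertex {v : A ⊕ P} (hv : IsUnmatched N v) : IsEvenVertex H N v :=
  ⟨v, hv, Walk.nil, Walk.IsPath.nil, List.isChain_nil, by simp⟩

open Classical in
-- Append the edge to a path reaching `x`. If `y` is already on that path, cut the path at `y`: in a
-- bipartite graph the ends determine the parity of the length. Otherwise the new edge is not in
-- `N`, since a last edge of the path would be the `N`-edge at `x`.
lemma IsEvenVertex.isOddVertex_of_adj (hN : IsMatching H N) {x y : A ⊕ P}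
    (hx : IsEvenVertex H N x) (h : (bipGraph H).Adj x y) : IsOddVertex H N y := by
  obtain ⟨u, hu, w, hp, ha, he⟩ := hx
  have hpar : Odd (w.concat h).length := by
    rw [Walk.length_concat]; exact he.add_one
  by_cases hy : y ∈ w.support
  · refine ⟨u, hu, w.takeUntil y hy, hp.takeUntil hy, ha.takeUntil hy, ?_⟩
    rw [(sideColoring H).odd_length_iff_not_congr] at hpar ⊢
    exact hpar
  · refine ⟨u, hu, w.concat h, hp.concat hy h, isAlternating_concat h ha fun s hs => ?_, hpar⟩
    obtain ⟨hxs, hmem⟩ := ha.getLast_mem_iff hu hs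
    refine iff_of_true (hmem.2 he) fun hxy => hy ?_
    obtain rfl := hN.sym2_eq (hmem.2 he) hxy hxs (Sym2.mem_mk_left _ _)
    exact w.snd_mem_support_of_mem_edges (List.mem_of_mem_getLast? hs)

open Classical in
lemma IsOddVertex.isEvenVertex_of_adj (hN : IsMatching H N) {x y : A ⊕ P}
    (hx : IsOddVertex H N x) (h : (bipGraph N).Adj x y) : IsEvenVertex H N y := by
  have h' := bipGraph_mono hN.1 h
  obtain ⟨u, hu, w, hp, ha, ho⟩ := hx
  have hpar : Even (w.concat h').length := by
    rw [Walk.length_concat]; exact ho.add_one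
  by_cases hy : y ∈ w.support
  · refine ⟨u, hu, w.takeUntil y hy, hp.takeUntil hy, ha.takeUntil hy, ?_⟩
    rw [(sideColoring H).even_length_iff_congr] at hpar ⊢
    exact hpar
  · refine ⟨u, hu, w.concat h', hp.concat hy h', isAlternating_concat h' ha fun s hs => ?_, hpar⟩
    obtain ⟨hxs, hmem⟩ := ha.getLast_mem_iff hu hs
    refine iff_of_false (fun hh => ?_) (not_not.2 h)
    exact Nat.not_even_iff_odd.2 ho (hmem.1 hh)

lemma IsOddVertex.exists_adj {y : A ⊕ P} (hy : IsOddVertex H N y) :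
    ∃ x, IsEvenVertex H N x ∧ (bipGraph H).Adj x y ∧ ¬ (bipGraph N).Adj x y := by
  obtain ⟨u, hu, w, hp, ha, ho⟩ := hy
  cases w using Walk.concatRec with
  | Hnil => simp at ho
  | @Hconcat _ x _ w h =>
    rw [Walk.concat_isPath_iff] at hp
    have hlast := ha.getLast_mem_iff hu (s := s(x, y)) (by simp)
    refine ⟨x, ⟨u, hu, w, hp.1, ha.of_concat, ?_⟩, h, fun hN => ?_⟩
    · rwa [Walk.length_concat, Nat.odd_add_one, Nat.not_odd_iff_even] at ho
    · exact Nat.not_even_iff_odd.2 ho (hlast.2.1 hN)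

lemma isUnreachableVertex_iff {v : A ⊕ P} :
    IsUnreachableVertex H N v ↔ ¬ IsEvenVertex H N v ∧ ¬ IsOddVertex H N v := by
  rw [IsUnreachableVertex, ← not_or, not_iff_not]
  constructor
  · rintro ⟨u, hu, w, h1, h2⟩
    rcases Nat.even_or_odd w.length with h | h
    · exact Or.inl ⟨u, hu, w, h1, h2, h⟩
    · exact Or.inr ⟨u, hu, w, h1, h2, h⟩
  · rintro (⟨u, hu, w, h1, h2, -⟩ | ⟨u, hu, w, h1, h2, -⟩)
    · exact ⟨u, hu, w, h1, h2⟩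
    · exact ⟨u, hu, w, h1, h2⟩

/-- No odd vertex is unmatched: there is no augmenting path for `N` in `H`. -/
def NoAugmentingPath (H N : Finset (A × P)) : Prop :=
  ∀ v, IsOddVertex H N v → Covers N v

/-- A wrong parity at the end of the walk propagates back along its last edge: an odd vertex makes
its `N`-partner even, an even vertex makes all its neighbours odd. At the start it would make an
unmatched vertex odd. -/
lemma NoAugmentingPath.even_odd (hN : IsMatching H N) (hna : NoAugmentingPath H N)
    {u v : A ⊕ P} (hu : IsUnmatched N u) (w : (bipGraph H).Walk u v) (ha : IsAlternating N w) :
    (Even w.length → ¬ IsOddVertex H N v) ∧ (Odd w.length → ¬ IsEvenVertex H N v) := by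
  induction w using Walk.concatRec with
  | Hnil =>
    refine ⟨fun _ h => isUnmatched_iff.1 hu (hna _ h), fun h => ?_⟩
    simp at h
  | @Hconcat u v x p h ih =>
    obtain ⟨ih1, ih2⟩ := ih hu ha.of_concat
    have hlast := ha.getLast_mem_iff hu (s := s(v, x)) (by simp)
    rw [Walk.length_concat] at hlast ⊢
    constructor
    · intro he hx
      have hvx : (bipGraph N).Adj x v := (hlast.2.2 he : (bipGraph N).Adj v x).symm
      exact ih2 (by rwa [Nat.even_add_one, Nat.not_even_iff_odd] at he)
        (hx.isEvenVertex_of_adj hN hvx)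
    · intro ho hx
      exact ih1 (by rwa [Nat.odd_add_one, Nat.not_odd_iff_even] at ho)
        (hx.isOddVertex_of_adj hN h.symm)

lemma IsEvenVertex.not_isOddVertex (hN : IsMatching H N) (hna : NoAugmentingPath H N)
    {v : A ⊕ P} (h : IsEvenVertex H N v) : ¬ IsOddVertex H N v := by
  obtain ⟨u, hu, w, -, ha, he⟩ := h
  exact (hna.even_odd hN hu w ha).1 he

/-! ### Augmentation -/

open Classical in
-- Exchanging the first two edges of the path frees its third vertex, from which the rest of the
-- path is again alternating between unmatched vertices. The clause that `u` also becomes covered is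
-- what the induction needs to recover the freed vertex.
lemma exists_augmentation {u v : A ⊕ P} (w : (bipGraph H).Walk u v) (hp : w.IsPath)
    (hN : IsMatching H N) (ha : IsAlternating N w) (hu : ¬ Covers N u) (hv : ¬ Covers N v)
    (huv : u ≠ v) :
    ∃ N', IsMatching H N' ∧ N.card < N'.card ∧ ∀ x, x = u ∨ Covers N x → Covers N' x := by
  induction hn : w.length using Nat.strong_induction_on generalizing N u with
  | _ n ih =>
  cases w with
  | nil => exact absurd rfl huv
  | @cons _ x _ h w =>
  obtain ⟨e, heH, he⟩ := adj_bipGraph.1 h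
  have heN : e ∉ N := fun hh => hu ⟨e, hh, he ▸ Sym2.mem_mk_left _ _⟩
  cases w with
  | nil =>
    refine ⟨insert e N, isMatching_iff.2 ⟨Finset.insert_subset heH hN.1, ?_⟩, ?_, ?_⟩
    · have key : ∀ f ∈ N, ∀ y, y ∈ ends e → y ∈ ends f → False := by
        intro f hf y hy hyf
        rw [he, Sym2.mem_iff] at hy
        rcases hy with rfl | rfl
        · exact hu ⟨f, hf, hyf⟩
        · exact hv ⟨f, hf, hyf⟩
      intro f hf g hg y hyf hyg
      rcases Finset.mem_insert.1 hf with hfe | hf <;> rcases Finset.mem_insert.1 hg with hge | hg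
      · rw [hfe, hge]
      · exact (key g hg y (hfe ▸ hyf) hyg).elim
      · exact (key f hf y (hge ▸ hyg) hyf).elim
      · exact hN.eq_of_mem_ends hf hg hyf hyg
    · rw [Finset.card_insert_of_notMem heN]; omega
    · rintro y (rfl | ⟨f, hf, hy⟩)
      · exact ⟨e, Finset.mem_insert_self _ _, he ▸ Sym2.mem_mk_left _ _⟩
      · exact ⟨f, Finset.mem_insert_of_mem hf, hy⟩
  | @cons _ y _ h2 w =>
    rw [IsAlternating, Walk.edges_cons, Walk.edges_cons, List.isChain_cons_cons] at ha
    have hfN : s(x, y) ∈ (bipGraph N).edgeSet := by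
      by_contra hh
      exact (isUnmatched_iff.2 hu).notMem_edgeSet (Sym2.mem_mk_left u x) (ha.1.2 hh)
    obtain ⟨f, hf, hfe⟩ := mem_edgeSet_bipGraph.1 hfN
    rw [Walk.cons_isPath_iff, Walk.cons_isPath_iff, Walk.support_cons] at hp
    obtain ⟨⟨hpw, hxw⟩, huw⟩ := hp
    simp only [List.mem_cons, not_or] at huw
    have hef : e ≠ f := fun hh => heN (hh ▸ hf)
    have hyx : x ≠ y := fun hh => hxw (hh ▸ w.start_mem_support)
    have hyu : u ≠ y := fun hh => huw.2 (hh ▸ w.start_mem_support)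
    have hvx : v ≠ x := fun hh => hxw (hh ▸ w.end_mem_support)
    set N1 := insert e (N.erase f) with hN1
    have memN1 : ∀ g, g ∈ N1 ↔ g = e ∨ (g ≠ f ∧ g ∈ N) := by simp [hN1]
    have key : ∀ g ∈ N, g ≠ f → ∀ z, z ∈ ends e → z ∈ ends g → False := by
      intro g hg hgf z hz hzg
      rw [he, Sym2.mem_iff] at hz
      rcases hz with rfl | rfl
      · exact hu ⟨g, hg, hzg⟩
      · exact hgf (hN.eq_of_mem_ends hg hf hzg (hfe ▸ Sym2.mem_mk_left _ _))
    have hM1 : IsMatching H N1 := by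
      refine isMatching_iff.2 ⟨?_, ?_⟩
      · intro g hg
        rcases (memN1 g).1 hg with rfl | hg
        · exact heH
        · exact hN.1 hg.2
      · intro g hg g' hg' z hz hz'
        rcases (memN1 g).1 hg with hge | hg <;> rcases (memN1 g').1 hg' with hge' | hg'
        · rw [hge, hge']
        · exact (key g' hg'.2 hg'.1 z (hge ▸ hz) hz').elim
        · exact (key g hg.2 hg.1 z (hge' ▸ hz') hz).elim
        · exact hN.eq_of_mem_ends hg.2 hg'.2 hz hz'
    have hcard : N1.card = N.card := by
      rw [hN1, Finset.card_insert_of_notMem (by simp [heN]), Finset.card_erase_add_one hf]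
    have hy1 : ¬ Covers N1 y := by
      rintro ⟨g, hg, hyg⟩
      rcases (memN1 g).1 hg with rfl | hg
      · rw [he, Sym2.mem_iff] at hyg
        rcases hyg with rfl | rfl
        · exact hyu rfl
        · exact hyx rfl
      · exact hg.1 (hN.eq_of_mem_ends hg.2 hf hyg (hfe ▸ Sym2.mem_mk_right _ _))
    have hv1 : ¬ Covers N1 v := by
      rintro ⟨g, hg, hyg⟩
      rcases (memN1 g).1 hg with rfl | hg
      · rw [he, Sym2.mem_iff] at hyg
        rcases hyg with rfl | rfl
        · exact huv rfl
        · exact hvx rfl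
      · exact hv ⟨g, hg.2, hyg⟩
    have hyv : y ≠ v := by
      rintro rfl
      exact hv ⟨f, hf, hfe ▸ Sym2.mem_mk_right _ _⟩
    have hiff : ∀ s ∈ w.edges, (s ∈ (bipGraph N).edgeSet ↔ s ∈ (bipGraph N1).edgeSet) := by
      intro s hs
      have hus : ∀ z ∈ s, z ∈ w.support := fun z hz => w.mem_support_of_mem_edges hs hz
      rw [mem_edgeSet_bipGraph, mem_edgeSet_bipGraph]
      constructor
      · rintro ⟨g, hg, rfl⟩
        refine ⟨g, (memN1 g).2 (Or.inr ⟨?_, hg⟩), rfl⟩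
        rintro rfl
        exact hxw (hus x (hfe ▸ Sym2.mem_mk_left _ _))
      · rintro ⟨g, hg, rfl⟩
        rcases (memN1 g).1 hg with rfl | hg
        · exact absurd (hus x (he ▸ Sym2.mem_mk_right _ _)) hxw
        · exact ⟨g, hg.2, rfl⟩
    have ha1 : IsAlternating N1 w := by
      refine List.IsChain.imp_of_mem_imp (fun s t hs ht hst => ?_) ha.2.tail
      rwa [← hiff s hs, ← hiff t ht]
    obtain ⟨N', h1, h2, h3⟩ := ih w.length (by rw [← hn]; simp) w hpw hM1 ha1 hy1 hv1 hyv rfl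
    have heN1 : e ∈ N1 := Finset.mem_insert_self _ _
    refine ⟨N', h1, hcard ▸ h2, ?_⟩
    rintro z (rfl | ⟨g, hg, hz⟩)
    · exact h3 _ (Or.inr ⟨e, heN1, he ▸ Sym2.mem_mk_left _ _⟩)
    · by_cases hgf : g = f
      · rw [hgf, hfe, Sym2.mem_iff] at hz
        rcases hz with rfl | rfl
        · exact h3 _ (Or.inr ⟨e, heN1, he ▸ Sym2.mem_mk_right _ _⟩)
        · exact h3 _ (Or.inl rfl)
      · exact h3 _ (Or.inr ⟨g, (memN1 g).2 (Or.inr ⟨hgf, hg⟩), hz⟩)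

end AlternatingPaths

/-! ### König covers and the structure of maximum matchings. -/

section VertexCovers

variable {A P : Type*} {H N K : Finset (A × P)}

lemma IsMaximumMatching.noAugmentingPath (h : IsMaximumMatching H N) : NoAugmentingPath H N := by
  rintro v ⟨u, hu, w, hp, ha, ho⟩
  by_contra hv
  have huv : u ≠ v := by
    rintro rfl
    rw [(sideColoring H).odd_length_iff_not_congr] at ho
    tauto
  obtain ⟨N', h1, h2, -⟩ := exists_augmentation w hp h.1 ha (isUnmatched_iff.1 hu) hv huv
  exact absurd (h.2 N' h1) (not_le.2 h2)

open Classical in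
lemma card_le_card_covered (hK : IsMatching H K) (C : Finset (A ⊕ P))
    (h : ∀ e ∈ K, ∃ v ∈ C, v ∈ ends e) : K.card ≤ (C.filter (Covers K)).card := by
  refine Finset.card_le_card_of_forall_subsingleton (fun e v => v ∈ ends e) (fun e he => ?_)
    (fun v _ e he e' he' => hK.eq_of_mem_ends he.1 he'.1 he.2 he'.2)
  obtain ⟨v, hv, hve⟩ := h e he
  exact ⟨v, Finset.mem_filter.2 ⟨hv, e, he, hve⟩, hve⟩

open Classical in
lemma card_covered_le_card (C : Finset (A ⊕ P))
    (h : ∀ e ∈ K, ∀ v ∈ C, ∀ w ∈ C, v ∈ ends e → w ∈ ends e → v = w) :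
    (C.filter (Covers K)).card ≤ K.card := by
  exact Finset.card_le_card_of_forall_subsingleton (fun v e => v ∈ ends e)
    (fun v hv => (Finset.mem_filter.1 hv).2)
    (fun e he v hv w hw => h e he v (Finset.mem_filter.1 hv.1).1 w (Finset.mem_filter.1 hw.1).1
      hv.2 hw.2)

/-- Each edge of `K` uses up its own vertex of `C`, so none is left over; an edge using two would
leave `C.card - 2` vertices to cover the other `K.card - 1` edges. -/
lemma tight_of_card_le (hK : IsMatching H K) {C : Finset (A ⊕ P)}
    (hC : ∀ e ∈ H, ∃ v ∈ C, v ∈ ends e) (hle : C.card ≤ K.card) :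
    (∀ v ∈ C, Covers K v) ∧
      ∀ e ∈ K, ∀ v ∈ C, ∀ w ∈ C, v ∈ ends e → w ∈ ends e → v = w := by
  classical
  constructor
  · have h1 := card_le_card_covered hK C fun e he => hC e (hK.1 he)
    exact Finset.filter_eq_self.1
      (Finset.eq_of_subset_of_card_le (Finset.filter_subset _ _) (hle.trans h1))
  · intro e he v hv w hw hve hwe
    by_contra hvw
    have hK' : IsMatching H (K.erase e) :=
      ⟨(Finset.erase_subset _ _).trans hK.1, fun f hf g hg =>
        hK.2 f (Finset.mem_of_mem_erase hf) g (Finset.mem_of_mem_erase hg)⟩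
    have h1 := card_le_card_covered hK' C fun f hf => hC f (hK'.1 hf)
    have h2 : C.filter (Covers (K.erase e)) ⊆ (C.erase v).erase w := by
      intro x hx
      obtain ⟨hxC, f, hf, hxf⟩ := Finset.mem_filter.1 hx
      have hx' : x ∉ ends e := fun hxe => (Finset.ne_of_mem_erase hf)
        (hK.eq_of_mem_ends (Finset.mem_of_mem_erase hf) he hxf hxe)
      refine Finset.mem_erase.2 ⟨?_, Finset.mem_erase.2 ⟨?_, hxC⟩⟩
      · rintro rfl; exact hx' hwe
      · rintro rfl; exact hx' hve
    have h3 := Finset.card_le_card h2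
    have h4 := Finset.card_erase_add_one he
    have h5 := Finset.card_erase_add_one hv
    have h6 := Finset.card_erase_add_one (Finset.mem_erase.2 ⟨fun h => hvw h.symm, hw⟩)
    omega

lemma NoAugmentingPath.not_isOddOddOrOddUnreachable (hN : IsMatching H N)
    (hna : NoAugmentingPath H N) {e : A × P} (he : e ∈ N) :
    ¬ IsOddOddOrOddUnreachable H N e := by
  have hadj : (bipGraph N).Adj (Sum.inl e.1) (Sum.inr e.2) := adj_bipGraph.2 ⟨e, he, rfl⟩
  have key : ∀ {x}, IsEvenVertex H N x → ¬ IsOddOrUnreachable H N x := by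
    rintro x hx (h | h)
    · exact hx.not_isOddVertex hN hna h
    · exact (isUnreachableVertex_iff.1 h).1 hx
  rintro (⟨h1, h2⟩ | ⟨h1, h2⟩)
  · exact key (h1.isEvenVertex_of_adj hN hadj) h2
  · exact key (h1.isEvenVertex_of_adj hN hadj.symm) h2

variable [Fintype A] [Fintype P]

open Classical in
/-- The odd vertices together with the unreachable vertices of one side. -/
noncomputable def oddCover (H N : Finset (A × P)) (b : Bool) : Finset (A ⊕ P) :=
  Finset.univ.filter fun v => IsOddVertex H N v ∨ (IsUnreachableVertex H N v ∧ v.isLeft = b)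

lemma mem_oddCover {b : Bool} {v : A ⊕ P} :
    v ∈ oddCover H N b ↔ IsOddVertex H N v ∨ (IsUnreachableVertex H N v ∧ v.isLeft = b) := by
  simp [oddCover]

lemma mem_oddCover_of_isOddOrUnreachable {v : A ⊕ P} (h : IsOddOrUnreachable H N v) :
    v ∈ oddCover H N v.isLeft := by
  rcases h with h | h
  · exact mem_oddCover.2 (Or.inl h)
  · exact mem_oddCover.2 (Or.inr ⟨h, rfl⟩)

/-- Neighbours of even vertices are odd, so an edge without an odd end has two unreachable ends, one
on each side. -/
lemma exists_mem_oddCover (hN : IsMatching H N) (b : Bool) {e : A × P} (he : e ∈ H) :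
    ∃ v ∈ oddCover H N b, v ∈ ends e := by
  have hadj : (bipGraph H).Adj (Sum.inl e.1) (Sum.inr e.2) := adj_bipGraph.2 ⟨e, he, rfl⟩
  have hx : (Sum.inl e.1 : A ⊕ P) ∈ ends e := Sym2.mem_mk_left _ _
  have hy : (Sum.inr e.2 : A ⊕ P) ∈ ends e := Sym2.mem_mk_right _ _
  by_cases h1 : IsOddVertex H N (Sum.inl e.1)
  · exact ⟨_, mem_oddCover.2 (Or.inl h1), hx⟩
  by_cases h2 : IsOddVertex H N (Sum.inr e.2)
  · exact ⟨_, mem_oddCover.2 (Or.inl h2), hy⟩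
  have h3 : ¬ IsEvenVertex H N (Sum.inl e.1) := fun h => h2 (h.isOddVertex_of_adj hN hadj)
  have h4 : ¬ IsEvenVertex H N (Sum.inr e.2) := fun h => h1 (h.isOddVertex_of_adj hN hadj.symm)
  cases b with
  | true => exact ⟨_, mem_oddCover.2 (Or.inr ⟨isUnreachableVertex_iff.2 ⟨h3, h1⟩, rfl⟩), hx⟩
  | false => exact ⟨_, mem_oddCover.2 (Or.inr ⟨isUnreachableVertex_iff.2 ⟨h4, h2⟩, rfl⟩), hy⟩

lemma eq_of_mem_oddCover {b : Bool} {e : A × P} (he : ¬ IsOddOddOrOddUnreachable H N e)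
    {v w : A ⊕ P} (hv : v ∈ oddCover H N b) (hw : w ∈ oddCover H N b) (hve : v ∈ ends e)
    (hwe : w ∈ ends e) : v = w := by
  have key : ¬ (Sum.inl e.1 ∈ oddCover H N b ∧ Sum.inr e.2 ∈ oddCover H N b) := by
    rintro ⟨h1, h2⟩
    apply he
    rw [mem_oddCover] at h1 h2
    simp only [IsOddOddOrOddUnreachable, IsOddOrUnreachable]
    rcases h1 with h1 | ⟨h1, hb⟩ <;> rcases h2 with h2 | ⟨h2, hb'⟩
    · tauto
    · tauto
    · tauto
    · simp [← hb] at hb'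
  simp only [ends, Sym2.mem_iff] at hve hwe
  rcases hve with rfl | rfl <;> rcases hwe with rfl | rfl
  · rfl
  · exact absurd ⟨hv, hw⟩ key
  · exact absurd ⟨hw, hv⟩ key
  · rfl

lemma NoAugmentingPath.card_oddCover_le (hN : IsMatching H N) (hna : NoAugmentingPath H N)
    (b : Bool) : (oddCover H N b).card ≤ N.card := by
  classical
  have h1 : (oddCover H N b).filter (Covers N) = oddCover H N b := by
    refine Finset.filter_true_of_mem fun v hv => ?_
    rcases mem_oddCover.1 hv with h | ⟨h, -⟩
    · exact hna v h
    · by_contra hh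
      exact (isUnreachableVertex_iff.1 h).1 (isUnmatched_iff.2 hh).isEvenVertex
  rw [← h1]
  exact card_covered_le_card _ fun e he v hv w hw hve hwe =>
    eq_of_mem_oddCover (hna.not_isOddOddOrOddUnreachable hN he) hv hw hve hwe

/-- The converse half of Berge's theorem, by exhibiting a vertex cover no larger than `N`. -/
lemma NoAugmentingPath.isMaximumMatching (hN : IsMatching H N) (hna : NoAugmentingPath H N) :
    IsMaximumMatching H N := by
  classical
  refine ⟨hN, fun K hK => ?_⟩
  calc K.card ≤ _ := card_le_card_covered hK (oddCover H N true) fun e he =>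
        exists_mem_oddCover hN true (hK.1 he)
    _ ≤ (oddCover H N true).card := Finset.card_le_card (Finset.filter_subset _ _)
    _ ≤ N.card := hna.card_oddCover_le hN true

lemma exists_larger_of_not_isMaximumMatching (hN : IsMatching H N)
    (h : ¬ IsMaximumMatching H N) :
    ∃ N', IsMatching H N' ∧ N.card < N'.card ∧ ∀ x, Covers N x → Covers N' x := by
  have hna : ¬ NoAugmentingPath H N := fun hna => h (hna.isMaximumMatching hN)
  simp only [NoAugmentingPath, not_forall] at hna
  obtain ⟨v, ⟨u, hu, w, hp, ha, ho⟩, hv⟩ := hna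
  have huv : u ≠ v := by
    rintro rfl
    rw [(sideColoring H).odd_length_iff_not_congr] at ho
    tauto
  obtain ⟨N', h1, h2, h3⟩ := exists_augmentation w hp hN ha (isUnmatched_iff.1 hu) hv huv
  exact ⟨N', h1, h2, fun x hx => h3 x (Or.inr hx)⟩

lemma IsMaximumMatching.tight_oddCover (hN : IsMaximumMatching H N) (hK : IsMaximumMatching H K)
    (b : Bool) : (∀ v ∈ oddCover H N b, Covers K v) ∧
      ∀ e ∈ K, ∀ v ∈ oddCover H N b, ∀ w ∈ oddCover H N b, v ∈ ends e → w ∈ ends e → v = w :=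
  tight_of_card_le hK.1 (fun _ he => exists_mem_oddCover hN.1 b he)
    ((hN.noAugmentingPath.card_oddCover_le hN.1 b).trans (hK.2 N hN.1))

/-- Every maximum matching covers the odd and the unreachable vertices. -/
lemma IsMaximumMatching.covers (hN : IsMaximumMatching H N) (hK : IsMaximumMatching H K)
    {v : A ⊕ P} (hv : IsOddOrUnreachable H N v) : Covers K v :=
  (hN.tight_oddCover hK _).1 v (mem_oddCover_of_isOddOrUnreachable hv)

/-- No maximum matching uses an edge between an odd and an odd or unreachable vertex. -/
lemma IsMaximumMatching.not_isOddOddOrOddUnreachable (hN : IsMaximumMatching H N)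
    (hK : IsMaximumMatching H K) {e : A × P} (he : e ∈ K) :
    ¬ IsOddOddOrOddUnreachable H N e := by
  have hx : (Sum.inl e.1 : A ⊕ P) ∈ ends e := Sym2.mem_mk_left _ _
  have hy : (Sum.inr e.2 : A ⊕ P) ∈ ends e := Sym2.mem_mk_right _ _
  rintro (⟨h1, h2⟩ | ⟨h1, h2⟩)
  · simpa using (hN.tight_oddCover hK _).2 e he _ (mem_oddCover.2 (Or.inl h1)) _
      (mem_oddCover_of_isOddOrUnreachable h2) hx hy
  · simpa using (hN.tight_oddCover hK _).2 e he _ (mem_oddCover_of_isOddOrUnreachable h2) _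
      (mem_oddCover.2 (Or.inl h1)) hx hy

end VertexCovers

/-! ### Rank-maximal matchings in the stages of the algorithm. -/

section Stages

variable {A P : Type*} {I : RankedInstance A P} {N : ℕ → Finset (A × P)}

/-- The edges of `K` of rank at most `i`. -/
def upTo (I : RankedInstance A P) (K : Finset (A × P)) (i : ℕ) : Finset (A × P) :=
  K.filter fun e => I.rank e.1 e.2 ≤ i

lemma mem_upTo {K : Finset (A × P)} {i : ℕ} {e : A × P} :
    e ∈ I.upTo K i ↔ e ∈ K ∧ I.rank e.1 e.2 ≤ i := Finset.mem_filter

lemma upTo_subset {K : Finset (A × P)} {i : ℕ} : I.upTo K i ⊆ K := Finset.filter_subset _ _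

lemma IsMatching.mono {H N N' H' : Finset (A × P)} (h : IsMatching H N) (h1 : N' ⊆ N)
    (h2 : N' ⊆ H') : IsMatching H' N' :=
  ⟨h2, fun e he f hf => h.2 e (h1 he) f (h1 hf)⟩

lemma mem_stageGraph {i : ℕ} {e : A × P} :
    e ∈ I.stageGraph N i ↔ e ∈ I.remaining N (i - 1) ∧ I.rank e.1 e.2 ≤ i := Finset.mem_filter

lemma mem_remaining_succ {i : ℕ} {e : A × P} :
    e ∈ I.remaining N (i + 1) ↔ e ∈ I.remaining N i ∧
      ¬ (i + 1 < I.rank e.1 e.2 ∧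
          (IsOddOrUnreachable (I.stageGraph N (i + 1)) (N (i + 1)) (Sum.inl e.1) ∨
            IsOddOrUnreachable (I.stageGraph N (i + 1)) (N (i + 1)) (Sum.inr e.2))) ∧
        ¬ (I.rank e.1 e.2 ≤ i + 1 ∧
          IsOddOddOrOddUnreachable (I.stageGraph N (i + 1)) (N (i + 1)) e) := by
  classical
  exact Finset.mem_filter

lemma remaining_antitone : Antitone (I.remaining N) :=
  antitone_nat_of_succ_le fun _ _ he => (mem_remaining_succ.1 he).1

lemma remaining_subset (i : ℕ) : I.remaining N i ⊆ I.E :=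
  remaining_antitone (Nat.zero_le i)

/-- After the deletions of stage `i + 1`, an edge of rank at most `i + 1` meets the cover exactly
once and an edge of higher rank does not meet it. -/
lemma card_upTo_eq [Fintype A] [Fintype P] {i : ℕ}
    (hN : IsMatching (I.stageGraph N (i + 1)) (N (i + 1))) {H K : Finset (A × P)}
    (hK : IsMatching H K) (hKr : K ⊆ I.remaining N (i + 1)) [DecidablePred (Covers K)] :
    (I.upTo K (i + 1)).card =
      ((oddCover (I.stageGraph N (i + 1)) (N (i + 1)) true).filter (Covers K)).card := by
  classical
  have hsub : I.upTo K (i + 1) ⊆ I.stageGraph N (i + 1) := fun e he =>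
    mem_stageGraph.2 ⟨remaining_antitone (Nat.le_succ i) (hKr (mem_upTo.1 he).1), (mem_upTo.1 he).2⟩
  have hcov : (oddCover (I.stageGraph N (i + 1)) (N (i + 1)) true).filter (Covers K) =
      (oddCover (I.stageGraph N (i + 1)) (N (i + 1)) true).filter
        (Covers (I.upTo K (i + 1))) := by
    refine Finset.filter_congr fun v hv => ⟨?_, fun ⟨e, he, hve⟩ => ⟨e, upTo_subset he, hve⟩⟩
    rintro ⟨e, he, hve⟩
    refine ⟨e, mem_upTo.2 ⟨he, ?_⟩, hve⟩
    by_contra hlt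
    have hv' : IsOddOrUnreachable (I.stageGraph N (i + 1)) (N (i + 1)) v :=
      (mem_oddCover.1 hv).imp_right And.left
    refine (mem_remaining_succ.1 (hKr he)).2.1 ⟨not_le.1 hlt, ?_⟩
    rcases Sym2.mem_iff.1 hve with rfl | rfl
    · exact Or.inl hv'
    · exact Or.inr hv'
  rw [hcov]
  apply le_antisymm
  · convert card_le_card_covered (hK.mono upTo_subset hsub) _ fun e he =>
      exists_mem_oddCover hN true (hsub he)
  · convert card_covered_le_card _ fun e he v hv w hw hve hwe => eq_of_mem_oddCover
      (fun h => (mem_remaining_succ.1 (hKr (mem_upTo.1 he).1)).2.2 ⟨(mem_upTo.1 he).2, h⟩)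
      hv hw hve hwe

lemma upTo_subset_remaining_succ {K : Finset (A × P)} {i : ℕ}
    (hN : IsMaximumMatching (I.stageGraph N (i + 1)) (N (i + 1)))
    {H : Finset (A × P)} (hK : IsMatching H K) (hKr : K ⊆ I.remaining N i)
    [Fintype A] [Fintype P]
    (hmax : IsMaximumMatching (I.stageGraph N (i + 1)) (I.upTo K (i + 1))) :
    K ⊆ I.remaining N (i + 1) := by
  intro e he
  refine mem_remaining_succ.2 ⟨hKr he, ?_, ?_⟩
  · rintro ⟨hlt, h⟩
    have key : ∀ v, v ∈ ends e →
        ¬ IsOddOrUnreachable (I.stageGraph N (i + 1)) (N (i + 1)) v := by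
      intro v hve hv
      obtain ⟨f, hf, hvf⟩ := hN.covers hmax hv
      obtain rfl := hK.eq_of_mem_ends he (upTo_subset hf) hve hvf
      exact absurd (mem_upTo.1 hf).2 (not_le.2 hlt)
    rcases h with h | h
    · exact key _ (Sym2.mem_mk_left _ _) h
    · exact key _ (Sym2.mem_mk_right _ _) h
  · rintro ⟨hle, h⟩
    exact hN.not_isOddOddOrOddUnreachable hmax (mem_upTo.2 ⟨he, hle⟩) h

lemma card_upTo_zero {K : Finset (A × P)} (hK : K ⊆ I.E) : (I.upTo K 0).card = 0 := by
  rw [Finset.card_eq_zero, upTo, Finset.filter_eq_empty_iff]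
  intro e he h
  have := I.one_le_rank e (hK he)
  omega

lemma card_upTo_succ (K : Finset (A × P)) (i : ℕ) :
    (I.upTo K (i + 1)).card = (I.upTo K i).card + I.signature K (i + 1) := by
  classical
  rw [signature, upTo, upTo, ← Finset.card_union_of_disjoint]
  · congr 1
    ext e
    simp only [Finset.mem_filter, Finset.mem_union, ← and_or_left]
    exact and_congr_right fun _ => by omega
  · rw [Finset.disjoint_filter]
    intro e _ h1 h2
    omega

/-- The signatures first differ where the cumulative counts first differ, which happens no later
than `i`. -/
lemma succ_of_card_upTo {K M : Finset (A × P)} (hK : K ⊆ I.E) (hM : M ⊆ I.E) {i : ℕ}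
    (hi : i ≤ I.r) (hle : ∀ j < i, (I.upTo M j).card ≤ (I.upTo K j).card)
    (hlt : (I.upTo M i).card < (I.upTo K i).card) : I.Succ K M := by
  classical
  have hex : ∃ k, (I.upTo M k).card ≠ (I.upTo K k).card := ⟨i, hlt.ne⟩
  obtain ⟨k, hk, hmin⟩ : ∃ k, (I.upTo M k).card ≠ (I.upTo K k).card ∧
      ∀ j < k, (I.upTo M j).card = (I.upTo K j).card :=
    ⟨Nat.find hex, Nat.find_spec hex, fun j hj => not_not.1 (Nat.find_min hex hj)⟩
  have hki : k ≤ i := by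
    by_contra h
    exact hlt.ne (hmin i (not_le.1 h))
  cases k with
  | zero => exact absurd (by rw [card_upTo_zero hK, card_upTo_zero hM]) hk
  | succ k =>
    refine ⟨k + 1, by omega, hki.trans hi, fun j h1 hj => ?_, ?_⟩
    · obtain ⟨j, rfl⟩ := Nat.exists_eq_add_of_le' h1
      have h2 := hmin (j + 1) hj
      have h3 := hmin j (by omega)
      rw [card_upTo_succ, card_upTo_succ] at h2
      omega
    · have h1 : (I.upTo M (k + 1)).card < (I.upTo K (k + 1)).card := by
        rcases hki.lt_or_eq with h | h
        · exact lt_of_le_of_ne (hle _ h) hk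
        · rwa [h]
      have h2 := hmin k (by omega)
      rw [card_upTo_succ, card_upTo_succ] at h1
      omega

/-- An edge of rank `ρ` is counted for `i = ρ, …, r - 1`, that is `r - ρ` times. -/
lemma sum_card_upTo {K : Finset (A × P)} (hK : K ⊆ I.E) :
    ∑ i ∈ Finset.range I.r, (I.upTo K i).card + ∑ e ∈ K, I.rank e.1 e.2 = K.card * I.r := by
  have h1 : ∑ i ∈ Finset.range I.r, (I.upTo K i).card = ∑ e ∈ K, (I.r - I.rank e.1 e.2) := by
    simp only [upTo, Finset.card_filter]
    rw [Finset.sum_comm]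
    refine Finset.sum_congr rfl fun e he => ?_
    rw [← Finset.card_filter]
    have : (Finset.range I.r).filter (fun i => I.rank e.1 e.2 ≤ i) =
        Finset.Ico (I.rank e.1 e.2) I.r := by
      ext i; simp; omega
    rw [this, Nat.card_Ico]
  rw [h1, ← Finset.sum_add_distrib, Finset.sum_const_nat (m := I.r)]
  intro e he
  have := I.rank_le e (hK he)
  omega

variable [Fintype A] [Fintype P] {M : Finset (A × P)}

lemma IsRankMaximal.subset_remaining (hN : I.IsRun N) (hM : I.IsRankMaximal M) (i : ℕ)
    (hi : i ≤ I.r) : M ⊆ I.remaining N i ∧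
      ∀ j, 1 ≤ j → j ≤ i → IsMaximumMatching (I.stageGraph N j) (I.upTo M j) := by
  classical
  induction i with
  | zero => exact ⟨hM.1.1, fun j h1 h2 => by omega⟩
  | succ i ih =>
    obtain ⟨hMr, hmax⟩ := ih (by omega)
    have hmat : IsMatching (I.stageGraph N (i + 1)) (I.upTo M (i + 1)) :=
      hM.1.mono upTo_subset fun e he =>
        mem_stageGraph.2 ⟨hMr (mem_upTo.1 he).1, (mem_upTo.1 he).2⟩
    have hnew : IsMaximumMatching (I.stageGraph N (i + 1)) (I.upTo M (i + 1)) := by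
      by_contra hnot
      -- `K` is itself the competitor: it discards the edges of `M` of rank above `i + 1`, which the
      -- lexicographic order forgives.
      obtain ⟨K, hK, hcard, hcov⟩ := exists_larger_of_not_isMaximumMatching hmat hnot
      have hKi : K ⊆ I.remaining N i := fun e he => (mem_stageGraph.1 (hK.1 he)).1
      have hKE := hKi.trans (remaining_subset i)
      refine hM.2 K (hK.mono subset_rfl hKE) (succ_of_card_upTo hKE hM.1.1 hi ?_ ?_)
      · intro j hj
        cases j with
        | zero => rw [card_upTo_zero hM.1.1]; exact Nat.zero_le _
        | succ j =>
          have hNj := (hN (j + 1) (by omega) (by omega)).1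
          have hanti := remaining_antitone (I := I) (N := N) (show j + 1 ≤ i by omega)
          have heq : I.upTo M (j + 1) = I.upTo (I.upTo M (i + 1)) (j + 1) := by
            ext e
            simp only [mem_upTo]
            constructor
            · rintro ⟨h1, h2⟩; exact ⟨⟨h1, by omega⟩, h2⟩
            · rintro ⟨⟨h1, -⟩, h2⟩; exact ⟨h1, h2⟩
          rw [heq, card_upTo_eq hNj hmat (upTo_subset.trans (hMr.trans hanti)),
            card_upTo_eq hNj hK (hKi.trans hanti)]
          exact Finset.card_le_card (Finset.monotone_filter_right _ fun v _ => hcov v)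
      · rwa [show I.upTo K (i + 1) = K from
          Finset.filter_true_of_mem fun e he => (mem_stageGraph.1 (hK.1 he)).2]
    refine ⟨upTo_subset_remaining_succ (hN _ (by omega) hi) hM.1 hMr hnew, fun j h1 h2 => ?_⟩
    rcases h2.lt_or_eq with h | rfl
    · exact hmax j h1 (by omega)
    · exact hnew

/-- A matching inside the reduced graph with as many edges as a rank-maximal matching and the
same total rank is rank-maximal. -/
lemma IsRankMaximal.of_sum_rank_eq (hN : I.IsRun N) (hM : I.IsRankMaximal M)
    {K : Finset (A × P)} (hK : IsMatching (I.reducedGraph N) K) (hcard : K.card = M.card)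
    (hsum : ∑ e ∈ K, I.rank e.1 e.2 = ∑ e ∈ M, I.rank e.1 e.2) : I.IsRankMaximal K := by
  have hKE : K ⊆ I.E := hK.1.trans (remaining_subset _)
  have hmax := (hM.subset_remaining hN I.r le_rfl).2
  have hle : ∀ i ∈ Finset.range I.r, (I.upTo K i).card ≤ (I.upTo M i).card := by
    intro i hi
    rw [Finset.mem_range] at hi
    rcases Nat.eq_zero_or_pos i with rfl | hpos
    · rw [card_upTo_zero hKE]; exact Nat.zero_le _
    · exact (hmax i hpos hi.le).2 _ (hK.mono upTo_subset fun e he => mem_stageGraph.2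
        ⟨remaining_antitone (by omega) (hK.1 (mem_upTo.1 he).1), (mem_upTo.1 he).2⟩)
  have h1 := sum_card_upTo hKE
  have h2 := sum_card_upTo hM.1.1
  -- Termwise inequalities with equal sums. The range omits `i = r`, where the count is the full
  -- cardinality.
  have heq := (Finset.sum_eq_sum_iff_of_le hle).1 (by rw [hcard] at h1; omega)
  have htop : ∀ {L : Finset (A × P)}, L ⊆ I.E → I.upTo L I.r = L := fun hL =>
    Finset.filter_true_of_mem fun e he => I.rank_le e (hL he)
  have heq' : ∀ i ≤ I.r, (I.upTo K i).card = (I.upTo M i).card := by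
    intro i hi
    rcases hi.lt_or_eq with h | rfl
    · exact heq i (Finset.mem_range.2 h)
    · rw [htop hKE, htop hM.1.1, hcard]
  have hsig : ∀ i, 1 ≤ i → i ≤ I.r → I.signature K i = I.signature M i := by
    intro i h1 hi
    obtain ⟨i, rfl⟩ := Nat.exists_eq_add_of_le' h1
    have h3 := heq' (i + 1) hi
    have h4 := heq' i (by omega)
    rw [card_upTo_succ, card_upTo_succ] at h3
    omega
  refine ⟨hK.mono subset_rfl hKE, ?_⟩
  rintro L hL ⟨k, hk1, hkr, h3, h4⟩
  refine hM.2 L hL ⟨k, hk1, hkr, fun i hi hik => ?_, ?_⟩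
  · rw [h3 i hi hik, hsig i hi (by omega)]
  · rwa [← hsig k hk1 hkr]

/-- A sink is left unmatched by every rank-maximal matching. -/
lemma IsSink.notMem (hr : 1 ≤ I.r) (hN : I.IsRun N) (hM : I.IsRankMaximal M) {p : P}
    (hp : I.IsSink N M p) (a : A) : (a, p) ∉ M := by
  intro hap
  -- Only the last stage `k + 1 = r` matters: there all remaining edges are present, and those not
  -- joining an odd vertex to an odd or unreachable one form the reduced graph.
  obtain ⟨k, hk⟩ := Nat.exists_eq_add_of_le' hr
  have hNk : IsMaximumMatching (I.stageGraph N (k + 1)) (N (k + 1)) :=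
    hN _ (by omega) hk.ge
  have heven : IsEvenVertex (I.stageGraph N (k + 1)) (N (k + 1)) (Sum.inr p) :=
    hp.2 _ (by omega) hk.ge
  have hna := hNk.noAugmentingPath
  have hMr := (hM.subset_remaining hN k (by omega)).1
  have hrank : ∀ {e}, e ∈ I.remaining N k → I.rank e.1 e.2 ≤ k + 1 := fun he =>
    hk ▸ I.rank_le _ (remaining_subset k he)
  have hred : ∀ {e}, e ∈ I.stageGraph N (k + 1) →
      ¬ IsOddOddOrOddUnreachable (I.stageGraph N (k + 1)) (N (k + 1)) e →
      e ∈ I.reducedGraph N := by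
    intro e he hne
    rw [reducedGraph, hk]
    have he' := mem_stageGraph.1 he
    exact mem_remaining_succ.2 ⟨he'.1, fun h => absurd he'.2 (not_le.2 h.1), fun h => hne h.2⟩
  have honly : ∀ q, (a, q) ∈ I.reducedGraph N → q = p := by
    intro q hq
    by_contra hqp
    exact hp.1 q hqp ⟨a, hap, hq⟩
  have hadj : (bipGraph (I.stageGraph N (k + 1))).Adj (Sum.inr p) (Sum.inl a) :=
    (adj_bipGraph.2 ⟨(a, p), mem_stageGraph.2 ⟨hMr hap, hrank (hMr hap)⟩, rfl⟩ :
      (bipGraph (I.stageGraph N (k + 1))).Adj (Sum.inl a) (Sum.inr p)).symm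
  have hodd := heven.isOddVertex_of_adj hNk.1 hadj
  -- The applicant `a` is odd, so `N (k + 1)` matches it, by an edge that survives into the reduced
  -- graph; `(a, p)` is the only such edge at `a`.
  have hNap : (a, p) ∈ N (k + 1) := by
    obtain ⟨⟨b, q⟩, he, hae⟩ := hna _ hodd
    obtain rfl : a = b := by simpa [ends] using hae
    obtain rfl := honly q (hred (hNk.1.1 he) (hna.not_isOddOddOrOddUnreachable hNk.1 he))
    exact he
  -- An alternating path enters `a` from an even post by an edge outside `N (k + 1)`. That edge also
  -- survives, so it would have to be `(a, p)`, a contradiction.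
  obtain ⟨x, hx, hxa, hxN⟩ := hodd.exists_adj
  obtain ⟨⟨b, q⟩, he, hends⟩ := adj_bipGraph.1 hxa
  rcases Sym2.eq_iff.1 hends with ⟨-, h⟩ | ⟨h, rfl⟩
  · simp at h
  obtain rfl : b = a := by simpa using h
  have hqp := honly q (hred he ?_)
  · exact hxN (adj_bipGraph.2 ⟨(b, q), hqp ▸ hNap, hends⟩)
  · have hxo := hx.not_isOddVertex hNk.1 hna
    rintro (⟨-, h | h⟩ | ⟨h, -⟩)
    · exact hxo h
    · exact (isUnreachableVertex_iff.1 h).1 hx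
    · exact hxo h

end Stages

/-! ### Switching preserves rank-maximality. -/

section Rematching

lemma IsMatching.fst_eq {A P : Type*} {H K : Finset (A × P)} (h : IsMatching H K) {a b : A} {p : P}
    (h1 : (a, p) ∈ K) (h2 : (b, p) ∈ K) : a = b :=
  congrArg Prod.fst (h.2 _ h1 _ h2 (Or.inr rfl))

variable {A P : Type*} [Fintype A] [Fintype P] {I : RankedInstance A P}
  {N : ℕ → Finset (A × P)} {M : Finset (A × P)}

/-- Moving the partner of `s i` to `t i` for every `i`, along edges of the switching graph of
total weight zero, preserves rank-maximality. -/
lemma IsRankMaximal.rematch (hN : I.IsRun N) (hM : I.IsRankMaximal M) {ι : Type*} [Fintype ι]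
    {s t : ι → P} (hs : Function.Injective s) (ht : Function.Injective t)
    (hedge : ∀ i, I.SwitchEdge N M (s i) (t i)) (hw : ∑ i, I.weight M (s i) (t i) = 0)
    (hst : ∀ a i, (a, t i) ∈ M → t i ∈ Set.range s) {K : Finset (A × P)}
    (hK : ∀ e, e ∈ K ↔ (e ∈ M ∧ e.2 ∉ Set.range s) ∨ ∃ i, (e.1, s i) ∈ M ∧ e.2 = t i) :
    I.IsRankMaximal K := by
  classical
  -- Paths and cycles are treated alike as a relabelling `σ` of posts, the identity off the sources.
  -- It is injective on matched posts because, by `hst`, a target occupied in `M` is itself a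
  -- source.
  set σ : P → P := Function.extend s t id with hσ
  have hσs : ∀ i, σ (s i) = t i := fun i => hs.extend_apply _ _ _
  have hσn : ∀ p, p ∉ Set.range s → σ p = p := fun p hp => Function.extend_apply' _ _ _ hp
  have hKσ : K = M.image fun e => (e.1, σ e.2) := by
    ext ⟨a, q⟩
    rw [hK, Finset.mem_image]
    constructor
    · rintro (⟨h1, h2⟩ | ⟨i, h1, h2⟩)
      · exact ⟨_, h1, by rw [hσn _ h2]⟩
      · exact ⟨_, h1, by rw [hσs, ← h2]⟩
    · rintro ⟨⟨b, p⟩, h1, h2⟩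
      obtain ⟨rfl, rfl⟩ := Prod.mk.inj h2
      by_cases hp : p ∈ Set.range s
      · obtain ⟨i, rfl⟩ := hp
        exact Or.inr ⟨i, h1, hσs i⟩
      · have hp' : σ p = p := hσn p hp
        simp only [hp']
        exact Or.inl ⟨h1, hp⟩
  have hMred : M ⊆ I.reducedGraph N := (hM.subset_remaining hN I.r le_rfl).1
  have hσinj : ∀ e ∈ M, ∀ f ∈ M, σ e.2 = σ f.2 → e.2 = f.2 := by
    rintro ⟨a, p⟩ he ⟨b, q⟩ hf h
    by_cases hp : p ∈ Set.range s <;> by_cases hq : q ∈ Set.range s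
    · obtain ⟨i, rfl⟩ := hp
      obtain ⟨j, rfl⟩ := hq
      simp only [hσs] at h
      rw [ht h]
    · obtain ⟨i, rfl⟩ := hp
      simp only [hσs, hσn _ hq] at h
      exact absurd (h ▸ hst b i (h ▸ hf)) hq
    · obtain ⟨i, rfl⟩ := hq
      simp only [hσs, hσn _ hp] at h
      exact absurd (h ▸ hst a i (h ▸ he)) hp
    · simpa only [hσn _ hp, hσn _ hq] using h
  have hinj : Set.InjOn (fun e : A × P => (e.1, σ e.2)) M := fun e he f hf h =>
    hM.1.2 e he f hf (Or.inl (Prod.mk.inj h).1)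
  have hmat : IsMatching (I.reducedGraph N) K := by
    constructor
    · intro e he
      rcases (hK e).1 he with h | ⟨i, h1, h2⟩
      · exact hMred h.1
      · obtain ⟨a, ha1, ha2⟩ := hedge i
        rw [show e = (a, t i) from Prod.ext (hM.1.fst_eq h1 ha1) h2]
        exact ha2
    · rw [hKσ]
      intro e' he' f' hf' h
      obtain ⟨e, he, rfl⟩ := Finset.mem_image.1 he'
      obtain ⟨f, hf, rfl⟩ := Finset.mem_image.1 hf'
      rw [hM.1.2 e he f hf (h.imp_right (hσinj e he f hf))]
  refine hM.of_sum_rank_eq hN hmat (by rw [hKσ, Finset.card_image_of_injOn hinj]) ?_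
  rw [hKσ, Finset.sum_image hinj]
  have hsum : ∑ i, I.weight M (s i) (t i) =
      ∑ e ∈ M, ((I.rank e.1 (σ e.2) : ℤ) - (I.rank e.1 e.2 : ℤ)) := by
    simp only [weight, Finset.sum_filter]
    rw [Finset.sum_comm]
    refine Finset.sum_congr rfl fun e he => ?_
    by_cases hp : e.2 ∈ Set.range s
    · obtain ⟨i, hi⟩ := hp
      rw [Finset.sum_eq_single i, if_pos hi.symm, ← hi, hσs]
      · rintro j - hj
        exact if_neg fun h => hj (hs (h ▸ hi).symm)
      · simp
    · rw [hσn _ hp, sub_self]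
      exact Finset.sum_eq_zero fun i _ => if_neg fun h => hp ⟨i, h.symm⟩
  rw [hw, Finset.sum_sub_distrib, eq_comm, sub_eq_zero] at hsum
  exact_mod_cast hsum

lemma IsRankMaximal.applyPath (hr : 1 ≤ I.r) (hN : I.IsRun N) (hM : I.IsRankMaximal M) {n : ℕ}
    {T : Fin (n + 1) → P} (hT : I.IsSwitchingPath N M T) :
    I.IsRankMaximal (RankedInstance.applyPath M T) := by
  classical
  obtain ⟨hinj, hedge, hsink, hw⟩ := hT
  have hlast : ∀ a, (a, T (Fin.last n)) ∉ M := hsink.notMem hr hN hM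
  -- The sources are all posts of `T` except the last; since the last is unmatched, the two ranges
  -- agree on matched posts.
  have hrange : ∀ {a p}, (a, p) ∈ M →
      (p ∈ Set.range T ↔ p ∈ Set.range fun i : Fin n => T i.castSucc) := by
    rintro a p hap
    constructor
    · rintro ⟨j, rfl⟩
      cases j using Fin.lastCases with
      | last => exact absurd hap (hlast a)
      | cast j => exact ⟨j, rfl⟩
    · rintro ⟨j, rfl⟩
      exact ⟨_, rfl⟩
  refine hM.rematch hN (hinj.comp (Fin.castSucc_injective n)) (hinj.comp (Fin.succ_injective n))
    hedge hw (fun a i h => (hrange h).1 ⟨_, rfl⟩) fun e => ?_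
  rw [RankedInstance.applyPath, Finset.mem_filter]
  simp only [Finset.mem_univ, true_and]
  exact or_congr_left (and_congr_right fun he => not_congr (hrange he))

lemma IsRankMaximal.applyCycle (hN : I.IsRun N) (hM : I.IsRankMaximal M) {n : ℕ}
    {C : Fin (n + 1) → P} (hC : I.IsSwitchingCycle N M C) :
    I.IsRankMaximal (RankedInstance.applyCycle M C) := by
  classical
  obtain ⟨hinj, hedge, hw⟩ := hC
  refine hM.rematch hN hinj (hinj.comp (add_left_injective 1)) hedge hw
    (fun a i _ => ⟨_, rfl⟩) fun e => ?_
  rw [RankedInstance.applyCycle, Finset.mem_filter]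
  simp

end Rematching

end RankedInstance

theorem mainTheorem2 {A P : Type*} [Fintype A] [Fintype P] (I : RankedInstance A P)
    (N : ℕ → Finset (A × (P ⊕ A))) (hN : I.withLastResorts.IsRun N)
    (M : Finset (A × (P ⊕ A))) (hM : I.withLastResorts.IsRankMaximal M) :
    (∀ (n : ℕ) (T : Fin (n + 1) → P ⊕ A), I.withLastResorts.IsSwitchingPath N M T →
      I.withLastResorts.IsRankMaximal (RankedInstance.applyPath M T)) ∧
    (∀ (n : ℕ) (C : Fin (n + 1) → P ⊕ A), I.withLastResorts.IsSwitchingCycle N M C →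
      I.withLastResorts.IsRankMaximal (RankedInstance.applyCycle M C)) :=
  ⟨fun _ _ hT => hM.applyPath (Nat.le_add_left 1 I.r) hN hT, fun _ _ hC => hM.applyCycle hN hC⟩
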